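/- **Proposition 5.1.** Let $B=(B(t))_{t\ge 0}$ be a standard real Brownian motion (with almost surely continuous paths). Put $W_0=B$, $W_m(t)=\int_0^t W_{m-1}(s)\,ds$ for $m\ge 1$, $t\ge 0$, and $X_m(t)=e^{-(m+\frac12)t}\,W_m(e^t)$ for $m\ge 0$, $t\in\mathbb R$. For $k,m\ge 0$ let $$A_{km}=(-1)^{k+m}\frac{(k+m)!}{m!\,(k-m)!}\ (m\le k),\qquad A_{km}=0\ (m>k),\qquad c_k=\frac{k!}{(2k)!},\qquad \sigma_k^2=\frac{c_k^2}{2k+1}.$$ Fix $n\ge 0$ and $t\in\mathbb R$. Let $A=(A_{km})_{0\le k,m\le n}$ and $\Lambda=\mathrm{diag}(2k+1)_{0\le k\le n}$. For $0\le k\le n$, the innovation $\hat X_k(t)=X_k(t)-E\big(X_k(t)\mid X_0(t),\dots,X_{k-1}(t)\big)$ equals $c_k\sum_{j=0}^k A_{kj}X_j(t)$ almost surely and has the centered normal density $u\mapsto \frac{1}{\sqrt{2\pi\sigma_k^2}}e^{-u^2/(2\sigma_k^2)}$. The random variable $X_0(t)$ has the density $p_0(x_0)=\frac{1}{\sqrt{2\pi\sigma_0^2}}e^{-x_0^2/(2\sigma_0^2)}$,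 and, for $1\le k\le n$, $X_k(t)$ given $X_0(t),\dots,X_{k-1}(t)$ has the conditional density $$p(x_k\mid x_0,\dots,x_{k-1})=\frac{1}{\sqrt{2\pi\sigma_k^2}}\,e^{-\hat x_k^2/(2\sigma_k^2)},\qquad \hat x_k=c_k\sum_{j=0}^k A_{kj}x_j.$$ The random vector $(X_0(t),\dots,X_n(t))$ has the (Gaussian) joint density, with respect to Lebesgue measure on $\mathbb R^{n+1}$, $$\begin{aligned}p_n(x)&=p_0(x_0)\prod_{k=1}^n p(x_k\mid x_0,\dots,x_{k-1})\\&=\Big(\prod_{k=0}^n\frac1{\sqrt{2\pi\sigma_k^2}}\Big)\exp\Big(-\tfrac12\sum_{k=0}^n(2k+1)\Big(\sum_{j=0}^kA_{kj}x_j\Big)^2\Big)\\&=\Big(\prod_{k=0}^n\frac1{\sqrt{2\pi\sigma_k^2}}\Big)\exp\Big(-\tfrac12\,(Ax)'\Lambda(Ax)\Big),\qquad x=(x_0,\dots,x_n)'\in\mathbb R^{n+1}.\end{aligned}$$ -/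

import Mathlib

open MeasureTheory ProbabilityTheory
open scoped NNReal ENNReal Matrix

namespace IntegratedBrownian

noncomputable section

/-! ### Densities and conditional densities -/

/-- `f` is a (nonnegative, measurable) density of the law of `Y` with respect to Lebesgue measure. -/
def IsDensity {Ω E : Type*} [MeasurableSpace Ω] [MeasureSpace E]
    (Y : Ω → E) (f : E → ℝ) (P : Measure Ω) : Prop :=
  Measurable f ∧ (∀ x, 0 ≤ f x) ∧
    HasLaw Y ((volume : Measure E).withDensity fun x => ENNReal.ofReal (f x)) P

/-- `f z y` is a conditional density, at `y`, of the real random variable `Y` given `Z = z`: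
the kernel `z ↦ f z y dy` is a regular conditional distribution of `Y` given `Z`. -/
def IsCondDensity {Ω S : Type*} [MeasurableSpace Ω] [MeasurableSpace S]
    (Y : Ω → ℝ) (Z : Ω → S) (f : S → ℝ → ℝ) (P : Measure Ω) : Prop :=
  Measurable (Function.uncurry f) ∧ (∀ z y, 0 ≤ f z y) ∧
    ∃ κ : Kernel S ℝ, IsMarkovKernel κ ∧
      (∀ z, κ z = (volume : Measure ℝ).withDensity fun y => ENNReal.ofReal (f z y)) ∧
      HasCondDistrib Y Z κ P

/-- The density at `u` of the centered normal law on `ℝ` with variance `v > 0`. -/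
def normalDensity (v u : ℝ) : ℝ :=
  1 / √(2 * Real.pi * v) * Real.exp (-(1 / (2 * v)) * u ^ 2)

/-! ### The processes -/

section Processes

variable {Ω : Type*}

/-- `n`-fold integrated Brownian motion, `W₀ = B` and `Wₙ₊₁(t) = ∫₀ᵗ Wₙ(s) ds` (used for `t ≥ 0`),
the integral being taken path by path. -/
def W (B : ℝ≥0 → Ω → ℝ) : ℕ → ℝ → Ω → ℝ
  | 0, t, ω => B t.toNNReal ω
  | n + 1, t, ω => ∫ s in (0 : ℝ)..t, W B n s ω

/-- The stationary transform `Xₙ(t) = e^{-(n + 1/2) t} Wₙ(eᵗ)`, `t ∈ ℝ`. -/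
def X (B : ℝ≥0 → Ω → ℝ) (n : ℕ) (t : ℝ) (ω : Ω) : ℝ :=
  Real.exp (-((n : ℝ) + 1 / 2) * t) * W B n (Real.exp t) ω

/-- The random vector `(X₀(t), …, X_{m-1}(t))` of the first `m` components. -/
def firstX (B : ℝ≥0 → Ω → ℝ) (m : ℕ) (t : ℝ) (ω : Ω) : Fin m → ℝ :=
  fun j => X B j t ω

/-- The innovation `X̂ₖ(t) = Xₖ(t) - E(Xₖ(t) | X₀(t), …, X_{k-1}(t))`. The conditional expectation
is the mean of the regular conditional distribution; this makes sense also when the `Xⱼ(t)` are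
measurable only up to null sets (the paths of `B` need only be continuous almost surely). -/
def innovation [MeasurableSpace Ω] (B : ℝ≥0 → Ω → ℝ) (P : Measure Ω) [IsFiniteMeasure P]
    (k : ℕ) (t : ℝ) (ω : Ω) : ℝ :=
  X B k t ω - ∫ y, y ∂(condDistrib (X B k t) (firstX B k t) P (firstX B k t ω))

end Processes

/-! ### The explicit constants -/

/-- `A_{km} = (-1)^{k+m} (k+m)! / (m! (k-m)!)` for `m ≤ k`, and `0` for `k < m`. -/
def coeffA (k m : ℕ) : ℝ :=
  if m ≤ k then
    (-1) ^ (k + m) * ((k + m).factorial : ℝ) / ((m.factorial : ℝ) * ((k - m).factorial : ℝ))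
  else 0

/-- The matrix `A` with rows and columns numbered `0, …, n`. -/
def matA (n : ℕ) : Matrix (Fin (n + 1)) (Fin (n + 1)) ℝ :=
  Matrix.of fun k m => coeffA k m

/-- The matrix `Λ = diag(2k+1)`, `k = 0, …, n`. -/
def matLambda (n : ℕ) : Matrix (Fin (n + 1)) (Fin (n + 1)) ℝ :=
  Matrix.diagonal fun k => 2 * ((k : ℕ) : ℝ) + 1

/-- The constant `k! / (2k)!`. -/
def coeffC (k : ℕ) : ℝ := (k.factorial : ℝ) / ((2 * k).factorial : ℝ)

/-- The innovation variance `σₖ² = (k! / (2k)!)² / (2k+1)`. -/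
def sigmaSq (k : ℕ) : ℝ := coeffC k ^ 2 / (2 * (k : ℝ) + 1)

end

end IntegratedBrownian

namespace Polynomial

/-! ### Orthogonality of the shifted Legendre polynomials -/

/-! Repeated integration by parts gives `W B m T` as the Wiener integral over `[0, T]` of `(T - s)^m
/ m!` against `B` (`wienerIntegral_kernelPoly`). With `T = e^t`, the combination `∑ A_{kj} X_j(t)`
is then the Wiener integral of `(-1)^k e^{-t/2} L_k(1 - s/e^t)`, where `L_k` is the shifted Legendre
polynomial (`eval_innovPoly`). The `L_k` are orthogonal on `[0, 1]` with squared norms `1/(2k+1)`,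
so these combinations are independent centered Gaussians with variances `1/(2k+1)`
(`iIndepFun_stdInnov`, `hasLaw_stdInnov`).

Since `c_k A_{kk} = 1`, multiplying the `k`-th combination by `c_k` gives a unitriangular transform
of `(X_0(t), ..., X_n(t))` with independent coordinates of variances `σ_k²`. Determinant one yields
the joint density without a Jacobian factor (`isDensity_firstX`). Also, `X_k(t)` is a linear
function of its predecessors plus an independent Gaussian, which gives the conditional law
(`hasCondDistrib_X`) and identifies the innovation (`innovation_ae_eq`).

Only polynomial integrands occur, so the Wiener integral can be defined path by path through
integration by parts; its Gaussian law comes from Riemann sums and characteristic functions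
(`hasLaw_wienerIntegral`). -/

lemma intervalIntegrable_eval (f : ℝ[X]) (a b : ℝ) :
    IntervalIntegrable (fun x => f.eval x) volume a b :=
  f.continuous.intervalIntegrable a b

lemma integral_eval_mul_derivative (f g : ℝ[X]) (a b : ℝ) :
    ∫ x in a..b, f.eval x * (derivative g).eval x =
      f.eval b * g.eval b - f.eval a * g.eval a -
        ∫ x in a..b, (derivative f).eval x * g.eval x :=
  intervalIntegral.integral_mul_deriv_eq_deriv_mul (fun x _ => f.hasDerivAt x) (fun x _ => g.hasDerivAt x)
    (intervalIntegrable_eval _ _ _) (intervalIntegrable_eval _ _ _)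

lemma integral_eval_mul_iterate_derivative (f g : ℝ[X]) (a b : ℝ) (k : ℕ)
    (ha : ∀ i < k, (derivative^[i] g).eval a = 0) (hb : ∀ i < k, (derivative^[i] g).eval b = 0) :
    ∫ x in a..b, f.eval x * (derivative^[k] g).eval x =
      (-1) ^ k * ∫ x in a..b, (derivative^[k] f).eval x * g.eval x := by
  induction k generalizing f with
  | zero => simp
  | succ k ih =>
    rw [Function.iterate_succ_apply', integral_eval_mul_derivative, ha k (by omega),
      hb k (by omega), ih (derivative f) (fun i hi => ha i (by omega))
        (fun i hi => hb i (by omega)), Function.iterate_succ_apply]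
    ring

/-- The Beta integral: one integration by parts trades a factor `1 - x` for a factor `x`. -/
lemma integral_pow_mul_one_sub_pow (a b : ℕ) :
    ∫ x in (0 : ℝ)..1, x ^ a * (1 - x) ^ b =
      (a.factorial * b.factorial : ℝ) / ((a + b + 1).factorial : ℝ) := by
  induction b generalizing a with
  | zero =>
    have : (a.factorial : ℝ) ≠ 0 := by positivity
    simp [Nat.factorial_succ]
    field_simp
  | succ b ih =>
    have h := integral_eval_mul_derivative (((1 : ℝ[X]) - X) ^ (b + 1)) (X ^ (a + 1)) 0 1
    have e1 : ∀ x : ℝ, (((1 : ℝ[X]) - X) ^ (b + 1)).eval x *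
        (derivative (X ^ (a + 1) : ℝ[X])).eval x =
          ((a : ℝ) + 1) * (x ^ a * (1 - x) ^ (b + 1)) := by
      intro x
      simp
      ring
    have e2 : ∀ x : ℝ, (derivative (((1 : ℝ[X]) - X) ^ (b + 1))).eval x *
        (X ^ (a + 1) : ℝ[X]).eval x = -((b : ℝ) + 1) * (x ^ (a + 1) * (1 - x) ^ b) := by
      intro x
      simp [derivative_pow]
      ring
    simp_rw [e1, e2, intervalIntegral.integral_const_mul] at h
    rw [ih (a + 1)] at h
    simp at h
    have ha : ((a : ℝ) + 1) ≠ 0 := by positivity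
    have e3 : a + 1 + b + 1 = a + (b + 1) + 1 := by ring
    rw [e3, Nat.factorial_succ a, eq_comm] at h
    have : ((a + (b + 1) + 1).factorial : ℝ) ≠ 0 := by positivity
    rw [Nat.factorial_succ b]
    push_cast at h ⊢
    apply mul_left_cancel₀ ha
    rw [← h]
    ring

/-- The shifted Legendre polynomial with real coefficients. -/
noncomputable def legendre (k : ℕ) : ℝ[X] := (shiftedLegendre k).map (Int.castRingHom ℝ)

lemma coeff_legendre (k j : ℕ) :
    (legendre k).coeff j = (-1) ^ j * (k.choose j : ℝ) * ((k + j).choose k : ℝ) := by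
  simp [legendre, coeff_map, coeff_shiftedLegendre]

lemma natDegree_legendre_le (k : ℕ) : (legendre k).natDegree ≤ k :=
  natDegree_map_le.trans (natDegree_shiftedLegendre k).le

lemma factorial_mul_legendre (k : ℕ) :
    (k.factorial : ℝ[X]) * legendre k = derivative^[k] ((X : ℝ[X]) ^ k * (1 - X) ^ k) := by
  have h := congrArg (Polynomial.map (Int.castRingHom ℝ)) (factorial_mul_shiftedLegendre_eq k)
  rw [Polynomial.map_mul, Polynomial.map_natCast, ← iterate_derivative_map] at h
  simpa [legendre] using h

/-- Rodrigues' formula and `k` integrations by parts; the boundary terms vanish because `x^k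
(1-x)^k` has zeros of order `k` at both end points. -/
lemma factorial_mul_integral_mul_legendre (f : ℝ[X]) (k : ℕ) :
    (k.factorial : ℝ) * ∫ x in (0 : ℝ)..1, f.eval x * (legendre k).eval x =
      (-1) ^ k * ∫ x in (0 : ℝ)..1, (derivative^[k] f).eval x * (x ^ k * (1 - x) ^ k) := by
  have h := integral_eval_mul_iterate_derivative f ((X : ℝ[X]) ^ k * (1 - X) ^ k) 0 1 k
    (fun i hi => by
      have : (X : ℝ[X]) ^ (k - i) ∣ derivative^[i] ((X : ℝ[X]) ^ k * (1 - X) ^ k) :=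
        pow_sub_dvd_iterate_derivative_of_pow_dvd i (dvd_mul_right _ _)
      obtain ⟨q, hq⟩ := this
      simp [hq, Nat.sub_ne_zero_of_lt hi])
    (fun i hi => by
      have : ((1 : ℝ[X]) - X) ^ (k - i) ∣ derivative^[i] ((X : ℝ[X]) ^ k * (1 - X) ^ k) :=
        pow_sub_dvd_iterate_derivative_of_pow_dvd i (dvd_mul_left _ _)
      obtain ⟨q, hq⟩ := this
      simp [hq, Nat.sub_ne_zero_of_lt hi])
  rw [← factorial_mul_legendre] at h
  simp only [eval_mul, eval_natCast, eval_pow, eval_X, eval_sub, eval_one] at h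
  rw [← h, ← intervalIntegral.integral_const_mul]
  congr 1 with x
  ring

lemma integral_legendre_mul_legendre_of_lt {k l : ℕ} (h : k < l) :
    ∫ x in (0 : ℝ)..1, (legendre k).eval x * (legendre l).eval x = 0 := by
  have h1 := factorial_mul_integral_mul_legendre (legendre k) l
  rw [iterate_derivative_eq_zero ((natDegree_legendre_le k).trans_lt h)] at h1
  have : (l.factorial : ℝ) ≠ 0 := by positivity
  simpa [this] using h1

lemma integral_legendre_sq (k : ℕ) :
    ∫ x in (0 : ℝ)..1, (legendre k).eval x * (legendre k).eval x = 1 / (2 * (k : ℝ) + 1) := by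
  have h1 := factorial_mul_integral_mul_legendre (legendre k) k
  -- The degree is at most `k`, so only the leading coefficient survives. Its sign cancels the one
  -- from the integrations by parts.
  have h2 : derivative^[k] (legendre k) =
      C ((k.factorial : ℝ) * ((-1) ^ k * ((k + k).choose k : ℝ))) := by
    rw [eq_C_of_natDegree_le_zero
      ((natDegree_iterate_derivative _ k).trans (by have := natDegree_legendre_le k; omega))]
    rw [coeff_iterate_derivative, zero_add, Nat.descFactorial_self, coeff_legendre]
    simp
  have hk : (k.factorial : ℝ) ≠ 0 := by positivity
  simp only [h2, eval_C, intervalIntegral.integral_const_mul, integral_pow_mul_one_sub_pow] at h1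
  apply mul_left_cancel₀ hk
  rw [h1]
  have h3 := Nat.add_choose_mul_factorial_mul_factorial k k
  have h4 : ((k + k).choose k : ℝ) * k.factorial * k.factorial = (k + k).factorial := by
    exact_mod_cast h3
  rw [Nat.factorial_succ (k + k)]
  have h5 : ((k + k).factorial : ℝ) ≠ 0 := by positivity
  have h6 : (-1 : ℝ) ^ k * (-1) ^ k = 1 := by rw [← mul_pow]; simp
  push_cast
  field_simp
  calc _ = ((-1 : ℝ) ^ k * (-1) ^ k) * (((k + k).choose k : ℝ) * k.factorial * k.factorial) *
        (2 * k + 1) := by ring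
    _ = _ := by rw [h6, h4]; ring

lemma integral_legendre_mul_legendre (k l : ℕ) :
    ∫ x in (0 : ℝ)..1, (legendre k).eval x * (legendre l).eval x =
      if k = l then 1 / (2 * (k : ℝ) + 1) else 0 := by
  split_ifs with h
  · rw [← h, integral_legendre_sq]
  · rcases lt_or_gt_of_ne h with h | h
    · exact integral_legendre_mul_legendre_of_lt h
    · simp_rw [mul_comm ((legendre k).eval _)]
      exact integral_legendre_mul_legendre_of_lt h

end Polynomial

namespace IntegratedBrownian

open Polynomial (legendre coeff_legendre)

/-! ### The constants and the Legendre coefficients -/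

/-- The bridge to Legendre polynomials: the `1/j!` is the one in the kernel `(T - s)^j / j!`. -/
lemma coeffA_div_factorial (k j : ℕ) :
    coeffA k j / (j.factorial : ℝ) = (-1) ^ k * (legendre k).coeff j := by
  rw [coeff_legendre, coeffA]
  split_ifs with h
  · have h1 : ((k + j).choose k : ℝ) * k.factorial * j.factorial = (k + j).factorial := by
      have := Nat.add_choose_mul_factorial_mul_factorial k j
      rw [← Nat.choose_symm_add] at this
      exact_mod_cast this
    have h2 : (k.choose j : ℝ) * j.factorial * (k - j).factorial = k.factorial := by
      exact_mod_cast Nat.choose_mul_factorial_mul_factorial h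
    have := Nat.factorial_ne_zero j
    have := Nat.factorial_ne_zero (k - j)
    rw [← h1, ← h2, pow_add]
    field_simp
  · rw [Nat.choose_eq_zero_of_lt (by omega)]
    simp

lemma coeffA_eq_zero {k m : ℕ} (h : k < m) : coeffA k m = 0 := if_neg (by omega)

lemma coeffC_pos (k : ℕ) : 0 < coeffC k := by
  unfold coeffC
  positivity

lemma sigmaSq_pos (k : ℕ) : 0 < sigmaSq k := by
  have := coeffC_pos k
  unfold sigmaSq
  positivity

lemma coeffC_mul_coeffA_self (k : ℕ) : coeffC k * coeffA k k = 1 := by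
  have h : (-1 : ℝ) ^ (k + k) = 1 := by rw [← two_mul, pow_mul]; simp
  have h1 := Nat.factorial_ne_zero k
  have h2 := Nat.factorial_ne_zero (2 * k)
  rw [coeffC, coeffA, if_pos le_rfl, h, ← two_mul]
  simp
  field_simp

end IntegratedBrownian

namespace IntegratedBrownian

open Filter Topology

/-! ### Riemann sums -/

/-- The `i`-th point of the subdivision of `[0, T]` into `N` equal intervals. -/
noncomputable def grid (T : ℝ) (N i : ℕ) : ℝ := i * (T / N)

lemma grid_zero (T : ℝ) (N : ℕ) : grid T N 0 = 0 := by simp [grid]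

lemma grid_self (T : ℝ) {N : ℕ} (hN : N ≠ 0) : grid T N N = T := by
  simp only [grid]
  field_simp

lemma grid_succ (T : ℝ) (N i : ℕ) : grid T N (i + 1) = grid T N i + T / N := by
  simp only [grid]
  push_cast
  ring

lemma monotone_grid {T : ℝ} (hT : 0 ≤ T) (N : ℕ) : Monotone (grid T N) :=
  monotone_nat_of_le_succ fun i => by
    rw [grid_succ]
    have : 0 ≤ T / N := by positivity
    linarith

lemma grid_nonneg {T : ℝ} (hT : 0 ≤ T) (N i : ℕ) : 0 ≤ grid T N i := by
  unfold grid
  positivity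

lemma grid_le {T : ℝ} (hT : 0 ≤ T) {N i : ℕ} (h : i ≤ N) (hN : N ≠ 0) : grid T N i ≤ T :=
  (monotone_grid hT N h).trans (grid_self T hN).le

lemma sum_integral_grid {T : ℝ} {N : ℕ} (hN : N ≠ 0) {f : ℝ → ℝ} (hf : Continuous f) :
    ∑ i ∈ Finset.range N, ∫ s in grid T N i..grid T N (i + 1), f s = ∫ s in (0 : ℝ)..T, f s := by
  rw [intervalIntegral.sum_integral_adjacent_intervals
    (fun i _ => hf.intervalIntegrable _ _), grid_zero, grid_self T hN]

/-- Riemann–Stieltjes sums with tags taken at left (`d = 0`) or right (`d = 1`) end points. -/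
lemma tendsto_sum_tag_mul_integral {T : ℝ} (hT : 0 ≤ T) {f g : ℝ → ℝ} (hf : Continuous f)
    (hg : Continuous g) {d : ℕ} (hd : d ≤ 1) :
    Tendsto (fun N : ℕ => ∑ i ∈ Finset.range N,
      f (grid T N (i + d)) * ∫ s in grid T N i..grid T N (i + 1), g s) atTop
      (𝓝 (∫ s in (0 : ℝ)..T, f s * g s)) := by
  set C := ∫ s in (0 : ℝ)..T, |g s| with hC
  have hC0 : 0 ≤ C := intervalIntegral.integral_nonneg hT fun _ _ => abs_nonneg _
  rw [Metric.tendsto_atTop]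
  intro ε hε
  have huc : UniformContinuousOn f (Set.Icc 0 T) :=
    isCompact_Icc.uniformContinuousOn_of_continuous hf.continuousOn
  -- The `+ 1` covers the case `C = 0` and makes the final bound strict.
  obtain ⟨δ, hδ, hfδ⟩ := Metric.uniformContinuousOn_iff.1 huc (ε / (C + 1)) (by positivity)
  obtain ⟨N₀, hN₀⟩ := exists_nat_gt (T / δ)
  refine ⟨N₀ + 1, fun N hN => ?_⟩
  have hN0 : N ≠ 0 := by omega
  have hNpos : (0 : ℝ) < N := by positivity
  have hmesh : T / N < δ := by
    rw [div_lt_iff₀ hNpos]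
    rw [div_lt_iff₀ hδ] at hN₀
    have : (N₀ : ℝ) ≤ N := by exact_mod_cast (by omega : N₀ ≤ N)
    nlinarith
  have key : ∀ i ∈ Finset.range N,
      |f (grid T N (i + d)) * (∫ s in grid T N i..grid T N (i + 1), g s) -
        ∫ s in grid T N i..grid T N (i + 1), f s * g s| ≤
      ∫ s in grid T N i..grid T N (i + 1), ε / (C + 1) * |g s| := by
    intro i hi
    have hi' : i + 1 ≤ N := Finset.mem_range.1 hi
    have hle : grid T N i ≤ grid T N (i + 1) := monotone_grid hT N (Nat.le_succ i)
    rw [← intervalIntegral.integral_const_mul, ← intervalIntegral.integral_sub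
      (Continuous.intervalIntegrable (by fun_prop) _ _)
      (Continuous.intervalIntegrable (by fun_prop) _ _)]
    refine (intervalIntegral.abs_integral_le_integral_abs hle).trans ?_
    refine intervalIntegral.integral_mono_on hle
      (Continuous.intervalIntegrable (by fun_prop) _ _)
      (Continuous.intervalIntegrable (by fun_prop) _ _) fun s hs => ?_
    rw [← sub_mul, abs_mul]
    refine mul_le_mul_of_nonneg_right ?_ (abs_nonneg _)
    have h1 : grid T N i ≤ grid T N (i + d) := monotone_grid hT N (by omega)
    have h2 : grid T N (i + d) ≤ grid T N (i + 1) := monotone_grid hT N (by omega)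
    have h3 := grid_succ T N i
    have h4 := grid_nonneg hT N i
    have h5 := grid_le hT hi' hN0
    have := hfδ (grid T N (i + d)) ⟨by linarith, by linarith⟩ s
      ⟨by linarith [hs.1], by linarith [hs.2]⟩ (by
        rw [Real.dist_eq, abs_lt]
        constructor <;> linarith [hs.1, hs.2])
    rw [Real.dist_eq] at this
    exact this.le
  rw [Real.dist_eq, ← sum_integral_grid hN0 (f := fun s => f s * g s) (by fun_prop), ← Finset.sum_sub_distrib]
  calc _ ≤ ∑ i ∈ Finset.range N, ∫ s in grid T N i..grid T N (i + 1), ε / (C + 1) * |g s| :=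
        (Finset.abs_sum_le_sum_abs _ _).trans (Finset.sum_le_sum key)
    _ = ε / (C + 1) * C := by
        rw [sum_integral_grid hN0 (by fun_prop), intervalIntegral.integral_const_mul]
    _ < ε := by
        rw [div_mul_eq_mul_div, div_lt_iff₀ (by positivity)]
        nlinarith

/-- Summation by parts: the products `h b` telescope, and what remains is a sum of `b` at right end
points against the increments of `h`, hence the case `d = 1` above. -/
lemma tendsto_sum_mul_increment {T : ℝ} (hT : 0 ≤ T) (h : Polynomial ℝ) {b : ℝ → ℝ}
    (hb : Continuous b) :
    Tendsto (fun N : ℕ => ∑ i ∈ Finset.range N,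
      h.eval (grid T N i) * (b (grid T N (i + 1)) - b (grid T N i))) atTop
      (𝓝 (h.eval T * b T - h.eval 0 * b 0 -
        ∫ s in (0 : ℝ)..T, b s * h.derivative.eval s)) := by
  refine (tendsto_const_nhds.sub (tendsto_sum_tag_mul_integral hT hb
    h.derivative.continuous le_rfl)).congr' ?_
  filter_upwards [eventually_ne_atTop 0] with N hN
  have htel := Finset.sum_range_sub (fun i => h.eval (grid T N i) * b (grid T N i)) N
  rw [grid_zero, grid_self T hN] at htel
  rw [← htel, ← Finset.sum_sub_distrib]
  refine Finset.sum_congr rfl fun i _ => ?_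
  rw [intervalIntegral.integral_eq_sub_of_hasDerivAt (fun x _ => h.hasDerivAt x)
    (h.derivative.continuous.intervalIntegrable _ _)]
  ring

/-! ### Integrals of polynomials against Brownian motion -/

variable {Ω : Type*}

/-- The Wiener integral `∫₀ᵀ h dB` of a polynomial, defined by integration by parts. -/
noncomputable def wienerIntegral (B : ℝ≥0 → Ω → ℝ) (T : ℝ) (h : Polynomial ℝ) (ω : Ω) : ℝ :=
  h.eval T * B T.toNNReal ω - ∫ s in (0 : ℝ)..T, B s.toNNReal ω * h.derivative.eval s

lemma continuous_path {B : ℝ≥0 → Ω → ℝ} {ω : Ω} (h : Continuous (B · ω)) :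
    Continuous fun s : ℝ => B s.toNNReal ω :=
  h.comp continuous_real_toNNReal

variable [MeasurableSpace Ω] {P : Measure Ω} {B : ℝ≥0 → Ω → ℝ}

lemma ae_tendsto_wienerIntegral (hB : IsBrownianReal B P) {T : ℝ} (hT : 0 ≤ T)
    (h : Polynomial ℝ) :
    ∀ᵐ ω ∂P, Tendsto (fun N : ℕ => ∑ i ∈ Finset.range N, h.eval (grid T N i) *
        (B (grid T N (i + 1)).toNNReal ω - B (grid T N i).toNNReal ω)) atTop
      (𝓝 (wienerIntegral B T h ω)) := by
  filter_upwards [hB.cont, hB.eval_zero_ae_eq_zero] with ω hω h0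
  simpa [h0, wienerIntegral] using tendsto_sum_mul_increment hT h (continuous_path hω)

lemma aemeasurable_wienerIntegral (hB : IsBrownianReal B P) {T : ℝ} (hT : 0 ≤ T)
    (h : Polynomial ℝ) : AEMeasurable (wienerIntegral B T h) P := by
  refine aemeasurable_of_tendsto_metrizable_ae atTop (fun N => ?_)
    (ae_tendsto_wienerIntegral hB hT h)
  have := hB.aemeasurable
  fun_prop

/-- Independence of the increments turns the characteristic function into a product of Gaussian
ones. Cell lengths are written as integrals of `1` so that the exponent is a Riemann sum with left
tags. -/
lemma charFun_map_sum_mul_increment [IsProbabilityMeasure P] (hB : IsBrownianReal B P) {T : ℝ} (hT : 0 ≤ T)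
    (h : Polynomial ℝ) (N : ℕ) (ξ : ℝ) :
    charFun (P.map fun ω => ∑ i ∈ Finset.range N, h.eval (grid T N i) *
        (B (grid T N (i + 1)).toNNReal ω - B (grid T N i).toNNReal ω)) ξ =
      Complex.exp (((-(ξ ^ 2 / 2) * ∑ i ∈ Finset.range N, h.eval (grid T N i) ^ 2 *
        ∫ _ in grid T N i..grid T N (i + 1), (1 : ℝ) : ℝ) : ℂ)) := by
  have hBm := hB.aemeasurable
  have hmono : Monotone fun i => (grid T N i).toNNReal :=
    fun _ _ hij => Real.toNNReal_mono (monotone_grid hT N hij)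
  have hind := (hB.hasIndepIncrements.nat hmono).comp
    (fun i x => h.eval (grid T N i) * x) (fun i => by fun_prop)
  have hind' : iIndepFun (fun (i : ℕ) ω => h.eval (grid T N i) *
        (B (grid T N (i + 1)).toNNReal ω - B (grid T N i).toNNReal ω)) P := hind
  rw [iIndepFun.charFun_map_fun_finsetSum_eq_prod (fun i _ => by fun_prop)
    (hind'.restrict _), Finset.prod_apply, Finset.mul_sum, Complex.ofReal_sum, Complex.exp_sum]
  refine Finset.prod_congr rfl fun i _ => ?_
  have hlaw := gaussianReal_const_mul (hB.hasLaw_sub (grid T N (i + 1)).toNNReal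
    (grid T N i).toNNReal) (h.eval (grid T N i))
  have := hlaw.map_eq
  simp only [Pi.sub_apply, mul_zero] at this
  have hle : grid T N i ≤ grid T N (i + 1) := monotone_grid hT N (Nat.le_succ i)
  have hd : ((nndist ((grid T N (i + 1)).toNNReal : ℝ) ((grid T N i).toNNReal : ℝ) : ℝ≥0) : ℝ) =
      grid T N (i + 1) - grid T N i := by
    rw [coe_nndist, Real.coe_toNNReal _ (grid_nonneg hT _ _),
      Real.coe_toNNReal _ (grid_nonneg hT _ _), Real.dist_eq, abs_of_nonneg (by linarith)]
  obtain ⟨v, hv, hmap⟩ : ∃ v : ℝ≥0, (v : ℝ) = h.eval (grid T N i) ^ 2 *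
      (grid T N (i + 1) - grid T N i) ∧ P.map (fun ω => h.eval (grid T N i) *
        (B (grid T N (i + 1)).toNNReal ω - B (grid T N i).toNNReal ω)) = gaussianReal 0 v :=
    ⟨_, (NNReal.coe_mul _ _).trans (congrArg (h.eval (grid T N i) ^ 2 * ·) hd), this⟩
  rw [hmap, charFun_gaussianReal, intervalIntegral.integral_const, smul_eq_mul, mul_one, ← hv]
  congr 1
  push_cast
  ring

/-- The characteristic functions of the Riemann sums converge in two ways: by dominated convergence
along almost every path, and explicitly through their exponents. Equating the limits gives the law.
-/
theorem hasLaw_wienerIntegral [IsProbabilityMeasure P] (hB : IsBrownianReal B P) {T : ℝ} (hT : 0 ≤ T)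
    (h : Polynomial ℝ) :
    HasLaw (wienerIntegral B T h)
      (gaussianReal 0 (∫ s in (0 : ℝ)..T, h.eval s ^ 2).toNNReal) P := by
  have hm := aemeasurable_wienerIntegral hB hT h
  have hBm := hB.aemeasurable
  have hpm := Measure.isProbabilityMeasure_map hm
  refine ⟨hm, Measure.ext_of_charFun ?_⟩
  ext ξ
  have hv : Tendsto (fun N : ℕ => Complex.exp (((-(ξ ^ 2 / 2) *
      ∑ i ∈ Finset.range N, h.eval (grid T N i) ^ 2 *
        ∫ _ in grid T N i..grid T N (i + 1), (1 : ℝ) : ℝ) : ℂ))) atTop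
      (𝓝 (Complex.exp ((-(ξ ^ 2 / 2) * ∫ s in (0 : ℝ)..T, h.eval s ^ 2 : ℝ) : ℂ))) := by
    have h1 := tendsto_sum_tag_mul_integral hT (f := fun s => h.eval s ^ 2) (g := fun _ => 1)
      (h.continuous.pow 2) continuous_const (Nat.zero_le 1)
    simp only [add_zero, mul_one] at h1
    exact ((Complex.continuous_exp.comp Complex.continuous_ofReal).tendsto _).comp
      (h1.const_mul _)
  have hlim : Tendsto (fun N : ℕ => charFun (P.map fun ω => ∑ i ∈ Finset.range N,
      h.eval (grid T N i) * (B (grid T N (i + 1)).toNNReal ω - B (grid T N i).toNNReal ω)) ξ)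
      atTop (𝓝 (charFun (P.map (wienerIntegral B T h)) ξ)) := by
    have he : ∀ f : Ω → ℝ, AEMeasurable f P →
        charFun (P.map f) ξ = ∫ ω, Complex.exp (ξ * f ω * Complex.I) ∂P := fun f hf => by
      rw [charFun_apply_real, integral_map hf (by fun_prop)]
    rw [he _ hm]
    simp_rw [fun N : ℕ => he (fun ω => ∑ i ∈ Finset.range N,
      h.eval (grid T N i) * (B (grid T N (i + 1)).toNNReal ω - B (grid T N i).toNNReal ω))
      (by fun_prop)]
    refine tendsto_integral_of_dominated_convergence (fun _ => 1) (fun N => ?_)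
      (integrable_const _) (fun N => .of_forall fun ω => ?_) ?_
    · refine AEMeasurable.aestronglyMeasurable ?_
      fun_prop
    · rw [← Complex.ofReal_mul, Complex.norm_exp_ofReal_mul_I]
    · filter_upwards [ae_tendsto_wienerIntegral hB hT h] with ω hω
      have hc : Continuous fun x : ℝ => Complex.exp (ξ * x * Complex.I) := by fun_prop
      exact (hc.tendsto _).comp hω
  simp_rw [charFun_map_sum_mul_increment hB hT] at hlim
  rw [tendsto_nhds_unique hlim hv, charFun_gaussianReal, Complex.ofReal_mul]
  have : ((∫ s in (0 : ℝ)..T, h.eval s ^ 2).toNNReal : ℂ) =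
      ((∫ s in (0 : ℝ)..T, h.eval s ^ 2 : ℝ) : ℂ) := by
    rw [← Real.coe_toNNReal (∫ s in (0 : ℝ)..T, h.eval s ^ 2)
      (intervalIntegral.integral_nonneg hT fun _ _ => sq_nonneg _)]
    simp
  rw [this]
  congr 1
  push_cast
  ring

end IntegratedBrownian

namespace IntegratedBrownian

open Polynomial (legendre)

/-! ### Iterated integrals as Wiener integrals -/

section Paths

variable {Ω : Type*} {B : ℝ≥0 → Ω → ℝ} {ω : Ω}

lemma continuous_W (h : Continuous (B · ω)) (m : ℕ) : Continuous fun s => W B m s ω := by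
  induction m with
  | zero => exact continuous_path h
  | succ m ih => exact intervalIntegral.continuous_primitive (fun _ _ => ih.intervalIntegrable _ _) 0

lemma hasDerivAt_W (h : Continuous (B · ω)) (m : ℕ) (s : ℝ) :
    HasDerivAt (fun s => W B (m + 1) s ω) (W B m s ω) s :=
  (continuous_W h m).integral_hasStrictDerivAt 0 s |>.hasDerivAt

/-- The polynomial `(T - s)ᵐ / m!` in `s`. -/
noncomputable def kernelPoly (T : ℝ) (m : ℕ) : Polynomial ℝ :=
  Polynomial.C (m.factorial : ℝ)⁻¹ * (Polynomial.C T - Polynomial.X) ^ m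

lemma eval_kernelPoly (T s : ℝ) (m : ℕ) :
    (kernelPoly T m).eval s = (m.factorial : ℝ)⁻¹ * (T - s) ^ m := by
  simp [kernelPoly]

lemma derivative_kernelPoly_zero (T : ℝ) : (kernelPoly T 0).derivative = 0 := by
  simp [kernelPoly]

lemma derivative_kernelPoly_succ (T : ℝ) (m : ℕ) :
    (kernelPoly T (m + 1)).derivative = -kernelPoly T m := by
  have hm : ((m.factorial : ℝ)) ≠ 0 := by positivity
  have hm' : ((m : ℝ) + 1) ≠ 0 := by positivity
  have h : Polynomial.C ((m + 1).factorial : ℝ)⁻¹ * ((m : Polynomial ℝ) + 1) =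
      Polynomial.C (m.factorial : ℝ)⁻¹ := by
    rw [← Polynomial.C_eq_natCast, ← Polynomial.C_1, ← Polynomial.C_add, ← Polynomial.C_mul]
    congr 1
    rw [Nat.factorial_succ]
    push_cast
    field_simp
  rw [kernelPoly, kernelPoly, ← h]
  simp [Polynomial.derivative_pow]
  ring

/-- Cauchy's formula for repeated integration. -/
lemma integral_kernelPoly_mul_W (h : Continuous (B · ω)) (T : ℝ) (j m : ℕ) :
    ∫ s in (0 : ℝ)..T, (kernelPoly T m).eval s * W B j s ω = W B (j + m + 1) T ω := by
  induction m generalizing j with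
  | zero => simp [eval_kernelPoly, W]
  | succ m ih =>
    rw [intervalIntegral.integral_mul_deriv_eq_deriv_mul
      (fun x _ => (kernelPoly T (m + 1)).hasDerivAt x) (fun x _ => hasDerivAt_W h j x)
      ((Polynomial.continuous _).intervalIntegrable _ _)
      ((continuous_W h j).intervalIntegrable _ _)]
    have h0 : W B (j + 1) 0 ω = 0 := by simp [W]
    simp only [derivative_kernelPoly_succ, Polynomial.eval_neg, neg_mul,
      intervalIntegral.integral_neg, ih (j + 1), h0, eval_kernelPoly (m := m + 1)]
    rw [show j + (m + 1) + 1 = j + 1 + m + 1 by ring]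
    simp

lemma wienerIntegral_kernelPoly (h : Continuous (B · ω)) (T : ℝ) (m : ℕ) :
    wienerIntegral B T (kernelPoly T m) ω = W B m T ω := by
  rcases m with _ | m
  · simp [wienerIntegral, derivative_kernelPoly_zero, eval_kernelPoly, W]
  · have := integral_kernelPoly_mul_W h T 0 m
    rw [zero_add] at this
    rw [← this]
    simp [wienerIntegral, derivative_kernelPoly_succ, eval_kernelPoly (m := m + 1), W, mul_comm]

lemma wienerIntegral_sum (h : Continuous (B · ω)) (T : ℝ) {ι : Type*} (s : Finset ι) (c : ι → ℝ)
    (f : ι → Polynomial ℝ) :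
    wienerIntegral B T (∑ i ∈ s, Polynomial.C (c i) * f i) ω =
      ∑ i ∈ s, c i * wienerIntegral B T (f i) ω := by
  have hp := continuous_path h
  simp only [wienerIntegral, Polynomial.derivative_sum, Polynomial.derivative_C_mul,
    Polynomial.eval_finsetSum, Polynomial.eval_mul, Polynomial.eval_C, Finset.mul_sum]
  have hc : ∀ i, Continuous fun x =>
      B x.toNNReal ω * (c i * (f i).derivative.eval x) := fun i =>
    hp.mul (continuous_const.mul (f i).derivative.continuous)
  rw [intervalIntegral.integral_finsetSum fun i _ => (hc i).intervalIntegrable _ _, Finset.sum_mul,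
    ← Finset.sum_sub_distrib]
  refine Finset.sum_congr rfl fun i _ => ?_
  rw [mul_sub, ← intervalIntegral.integral_const_mul]
  congr 1
  · ring
  · congr 1 with x
    ring

/-- The standardized innovation `∑_{j ≤ k} A_{kj} Xⱼ(t)`. -/
noncomputable def stdInnov (B : ℝ≥0 → Ω → ℝ) (k : ℕ) (t : ℝ) (ω : Ω) : ℝ :=
  ∑ j ∈ Finset.range (k + 1), coeffA k j * X B j t ω

/-- The integrand representing the standardized innovation as a Wiener integral. -/
noncomputable def innovPoly (k : ℕ) (t : ℝ) : Polynomial ℝ :=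
  ∑ j ∈ Finset.range (k + 1),
    Polynomial.C (coeffA k j * Real.exp (-((j : ℝ) + 1 / 2) * t)) * kernelPoly (Real.exp t) j

lemma wienerIntegral_innovPoly (h : Continuous (B · ω)) (k : ℕ) (t : ℝ) :
    wienerIntegral B (Real.exp t) (innovPoly k t) ω = stdInnov B k t ω := by
  rw [innovPoly, wienerIntegral_sum h, stdInnov]
  refine Finset.sum_congr rfl fun j _ => ?_
  rw [wienerIntegral_kernelPoly h, X, mul_assoc]

/-- The scaling of `X` makes the kernels homogeneous: `e^{-(j+1/2)t} (e^t - s)^j = e^{-t/2} (1 -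
s/e^t)^j`, so the sum is a polynomial in `1 - s/e^t`. -/
lemma eval_innovPoly (k : ℕ) (t s : ℝ) :
    (innovPoly k t).eval s =
      (-1) ^ k * Real.exp (-(t / 2)) * (legendre k).eval (1 - s / Real.exp t) := by
  have hk := Polynomial.natDegree_legendre_le k
  rw [Polynomial.eval_eq_sum_range' (p := legendre k) (n := k + 1) (by omega), innovPoly,
    Polynomial.eval_finsetSum, Finset.mul_sum]
  refine Finset.sum_congr rfl fun j _ => ?_
  have he : Real.exp (-((j : ℝ) + 1 / 2) * t) = Real.exp (-(t / 2)) / Real.exp t ^ j := by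
    rw [← Real.exp_nat_mul, ← Real.exp_sub]
    congr 1
    ring
  have ht := Real.exp_ne_zero t
  have h1 : (1 - s / Real.exp t) = (Real.exp t - s) / Real.exp t := by field_simp
  have h2 := coeffA_div_factorial k j
  rw [Polynomial.eval_mul, Polynomial.eval_C, eval_kernelPoly, he, h1, div_pow]
  calc _ = (coeffA k j / (j.factorial : ℝ)) * Real.exp (-(t / 2)) *
        ((Real.exp t - s) ^ j / Real.exp t ^ j) := by ring
    _ = _ := by rw [h2]; ring

lemma integral_innovPoly_mul_innovPoly (k l : ℕ) (t : ℝ) :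
    ∫ s in (0 : ℝ)..Real.exp t, (innovPoly k t).eval s * (innovPoly l t).eval s =
      if k = l then 1 / (2 * (k : ℝ) + 1) else 0 := by
  have ht := Real.exp_ne_zero t
  -- The substitution `x = 1 - s/e^t` has Jacobian `e^t`, which cancels the two factors `e^{-t/2}`.
  have h := intervalIntegral.integral_comp_sub_div (a := 0) (b := Real.exp t)
    (fun x => (legendre k).eval x * (legendre l).eval x) ht 1
  simp only [zero_div, sub_zero, div_self ht, sub_self, smul_eq_mul,
    Polynomial.integral_legendre_mul_legendre] at h
  have he : Real.exp (-(t / 2)) * Real.exp (-(t / 2)) * Real.exp t = 1 := by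
    rw [← Real.exp_add, ← Real.exp_add]
    ring_nf
    exact Real.exp_zero
  calc _ = ∫ s in (0 : ℝ)..Real.exp t,
        ((-1) ^ k * (-1) ^ l * (Real.exp (-(t / 2)) * Real.exp (-(t / 2)))) *
        ((legendre k).eval (1 - s / Real.exp t) * (legendre l).eval (1 - s / Real.exp t)) := by
        congr 1 with s
        rw [eval_innovPoly, eval_innovPoly]
        ring
    _ = ((-1) ^ k * (-1) ^ l) * (Real.exp (-(t / 2)) * Real.exp (-(t / 2)) * Real.exp t) *
        (if k = l then 1 / (2 * (k : ℝ) + 1) else 0) := by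
        rw [intervalIntegral.integral_const_mul, h]
        ring
    _ = _ := by
        rw [he]
        split_ifs with hkl
        · have : (-1 : ℝ) ^ k * (-1) ^ k = 1 := by rw [← mul_pow]; simp
          rw [← hkl, this]
          ring
        · simp

lemma integral_sum_innovPoly_sq {n : ℕ} (c : Fin n → ℝ) (t : ℝ) :
    ∫ s in (0 : ℝ)..Real.exp t,
      (∑ k : Fin n, Polynomial.C (c k) * innovPoly k t).eval s ^ 2 =
      ∑ k : Fin n, c k ^ 2 / (2 * ((k : ℕ) : ℝ) + 1) := by
  have h1 : ∀ s, (∑ k : Fin n, Polynomial.C (c k) * innovPoly k t).eval s ^ 2 =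
      ∑ k : Fin n, ∑ l : Fin n,
        (c k * c l) * ((innovPoly k t).eval s * (innovPoly l t).eval s) := by
    intro s
    simp only [Polynomial.eval_finsetSum, Polynomial.eval_mul, Polynomial.eval_C]
    rw [sq, Finset.sum_mul_sum]
    refine Finset.sum_congr rfl fun k _ => Finset.sum_congr rfl fun l _ => ?_
    ring
  have hc : ∀ k l : Fin n, Continuous fun s =>
      (c k * c l) * ((innovPoly k t).eval s * (innovPoly l t).eval s) := fun k l =>
    continuous_const.mul ((Polynomial.continuous _).mul (Polynomial.continuous _))
  simp_rw [h1]
  rw [intervalIntegral.integral_finsetSum fun k _ =>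
    (continuous_finsetSum _ fun l _ => hc k l).intervalIntegrable _ _]
  refine Finset.sum_congr rfl fun k _ => ?_
  rw [intervalIntegral.integral_finsetSum fun l _ => (hc k l).intervalIntegrable _ _]
  simp_rw [intervalIntegral.integral_const_mul, integral_innovPoly_mul_innovPoly, Fin.val_inj]
  simp
  ring

end Paths

/-! ### Joint law of the standardized innovations -/

section Law

variable {Ω : Type*} [MeasurableSpace Ω] {P : Measure Ω} [IsProbabilityMeasure P]
  {B : ℝ≥0 → Ω → ℝ}

/-- Any linear combination is again one Wiener integral, so its law needs only the squared norm of
the combined integrand. -/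
lemma hasLaw_sum_mul_stdInnov (hB : IsBrownianReal B P) {n : ℕ} (c : Fin n → ℝ) (t : ℝ) :
    HasLaw (fun ω => ∑ k : Fin n, c k * stdInnov B k t ω)
      (gaussianReal 0 (∑ k : Fin n, c k ^ 2 / (2 * ((k : ℕ) : ℝ) + 1)).toNNReal) P := by
  rw [← integral_sum_innovPoly_sq]
  refine (hasLaw_wienerIntegral hB (Real.exp_nonneg t)
    (∑ k : Fin n, Polynomial.C (c k) * innovPoly k t)).congr ?_
  filter_upwards [hB.cont] with ω hω
  rw [wienerIntegral_sum hω]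
  exact Finset.sum_congr rfl fun k _ => by rw [wienerIntegral_innovPoly hω]

lemma hasLaw_stdInnov (hB : IsBrownianReal B P) (k : ℕ) (t : ℝ) :
    HasLaw (stdInnov B k t) (gaussianReal 0 (1 / (2 * (k : ℝ) + 1)).toNNReal) P := by
  have h := hasLaw_sum_mul_stdInnov hB (Pi.single (Fin.last k) 1) t
  have h1 : ∀ f : Fin (k + 1) → ℝ,
      ∑ i, (Pi.single (Fin.last k) 1 : Fin (k + 1) → ℝ) i * f i = f (Fin.last k) := by
    intro f
    simp [Pi.single_apply]
  have h2 : ∑ i : Fin (k + 1), (Pi.single (Fin.last k) 1 : Fin (k + 1) → ℝ) i ^ 2 /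
      (2 * ((i : ℕ) : ℝ) + 1) = 1 / (2 * (k : ℝ) + 1) := by
    rw [Finset.sum_eq_single (Fin.last k)] <;> simp +contextual
  rw [h2] at h
  refine h.congr (.of_forall fun ω => ?_)
  exact (h1 fun i => stdInnov B i t ω).symm

lemma aemeasurable_stdInnov (hB : IsBrownianReal B P) (k : ℕ) (t : ℝ) :
    AEMeasurable (stdInnov B k t) P :=
  (hasLaw_stdInnov hB k t).aemeasurable

/-- The joint characteristic function at `c` is that of the combination `∑ c_k stdInnov_k` at `1`;
by orthogonality its exponent has no cross terms, so it factorizes. -/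
lemma iIndepFun_stdInnov (hB : IsBrownianReal B P) (n : ℕ) (t : ℝ) :
    iIndepFun (fun k : Fin n => stdInnov B k t) P := by
  have hm := fun k => aemeasurable_stdInnov hB k t
  rw [iIndepFun_iff_charFun_pi fun i : Fin n => hm i]
  intro c
  have h := hasLaw_sum_mul_stdInnov hB (fun i => c i) t
  have h1 : charFun (P.map fun ω => WithLp.toLp 2 fun k : Fin n => stdInnov B k t ω) c =
      charFun (P.map fun ω => ∑ k : Fin n, c k * stdInnov B k t ω) 1 := by
    rw [charFun_apply, charFun_apply_real, integral_map (by fun_prop) (by fun_prop),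
      integral_map h.aemeasurable (by fun_prop)]
    congr 1 with ω
    simp [PiLp.inner_apply]
  have hnn : ∀ x : ℝ, 0 ≤ x → ((x.toNNReal : ℝ≥0) : ℂ) = ((x : ℝ) : ℂ) := fun x hx => by
    conv_rhs => rw [← Real.coe_toNNReal x hx]
  simp_rw [h1, h.map_eq, (hasLaw_stdInnov hB _ t).map_eq, charFun_gaussianReal, ← Complex.exp_sum]
  rw [hnn _ (Finset.sum_nonneg fun i _ => by positivity)]
  simp_rw [hnn _ (by positivity : (0 : ℝ) ≤ 1 / (2 * ((_ : ℕ) : ℝ) + 1))]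
  congr 1
  push_cast
  simp [Finset.sum_div]
  refine Finset.sum_congr rfl fun i _ => ?_
  ring

end Law

end IntegratedBrownian

/-! ### General facts on densities and conditional distributions -/

namespace MeasureTheory

lemma lintegral_pi_prod_eq_prod {n : ℕ} (f : Fin n → ℝ → ℝ≥0∞) (hf : ∀ i, Measurable (f i)) :
    ∫⁻ x : Fin n → ℝ, ∏ i, f i (x i) = ∏ i, ∫⁻ y, f i y := by
  induction n with
  | zero => simp [volume_pi]
  | succ n ih =>
    have hm : Measurable fun x : Fin n → ℝ => ∏ i : Fin n, f i.succ (x i) :=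
      Finset.measurable_fun_prod _ fun i _ => (hf _).comp (measurable_pi_apply i)
    rw [← ((volume_preserving_piFinSuccAbove (fun _ : Fin (n + 1) => ℝ) 0).symm).lintegral_comp_emb
      (MeasurableEquiv.measurableEmbedding _)]
    simp_rw [MeasurableEquiv.piFinSuccAbove_symm_apply, Fin.insertNthEquiv, Fin.prod_univ_succ]
    simp only [Fin.insertNth_zero, Equiv.coe_fn_mk, Fin.cons_succ, Fin.cons_zero]
    rw [← ih _ fun i => hf i.succ]
    exact lintegral_prod_mul (hf 0).aemeasurable hm.aemeasurable

lemma pi_withDensity_eq {n : ℕ} (f : Fin n → ℝ → ℝ≥0∞) (hf : ∀ i, Measurable (f i))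
    [∀ i, SigmaFinite ((volume : Measure ℝ).withDensity (f i))] :
    Measure.pi (fun i => (volume : Measure ℝ).withDensity (f i)) =
      (volume : Measure (Fin n → ℝ)).withDensity fun x => ∏ i, f i (x i) := by
  refine Measure.pi_eq fun s hs => ?_
  rw [withDensity_apply _ (MeasurableSet.univ_pi hs),
    ← lintegral_indicator (MeasurableSet.univ_pi hs)]
  have h1 : ∀ i, (volume : Measure ℝ).withDensity (f i) (s i) =
      ∫⁻ y, (s i).indicator (f i) y := fun i => by
    rw [withDensity_apply _ (hs i), lintegral_indicator (hs i)]
  simp_rw [h1]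
  rw [← lintegral_pi_prod_eq_prod _ fun i => (hf i).indicator (hs i)]
  congr 1 with x
  by_cases hx : x ∈ Set.univ.pi s
  · rw [Set.indicator_of_mem hx]
    exact Finset.prod_congr rfl fun i _ => (Set.indicator_of_mem (hx i trivial) _).symm
  · rw [Set.indicator_of_notMem hx]
    simp only [Set.mem_univ_pi, not_forall] at hx
    obtain ⟨i, hi⟩ := hx
    exact (Finset.prod_eq_zero (Finset.mem_univ i) (Set.indicator_of_notMem hi _)).symm

end MeasureTheory

namespace ProbabilityTheory

variable {Ω : Type*} [MeasurableSpace Ω] {P : Measure Ω}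

/-- A linear map of determinant one preserves Lebesgue measure, so the density is simply composed
with it. -/
lemma HasLaw.withDensity_of_mulVec {n : ℕ} {M : Matrix (Fin n) (Fin n) ℝ} (hM : M.det = 1)
    {Y : Ω → Fin n → ℝ} {g : (Fin n → ℝ) → ℝ≥0∞} (hg : Measurable g)
    (h : HasLaw (fun ω => M *ᵥ Y ω) (volume.withDensity g) P) :
    HasLaw Y (volume.withDensity fun x => g (M *ᵥ x)) P := by
  have hu : IsUnit M.det := by simp [hM]
  have hM1 : Measurable fun x : Fin n → ℝ => M *ᵥ x :=
    (Continuous.matrix_mulVec continuous_const continuous_id).measurable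
  have hM2 : Measurable fun x : Fin n → ℝ => M⁻¹ *ᵥ x :=
    (Continuous.matrix_mulVec continuous_const continuous_id).measurable
  have hl : ∀ x, M⁻¹ *ᵥ (M *ᵥ x) = x := fun x => by
    rw [Matrix.mulVec_mulVec, Matrix.nonsing_inv_mul _ hu, Matrix.one_mulVec]
  have hY : Y = fun ω => M⁻¹ *ᵥ (M *ᵥ Y ω) := funext fun ω => (hl _).symm
  have hvol : (volume : Measure (Fin n → ℝ)).map (fun x => M *ᵥ x) = volume := by
    have := Real.map_matrix_volume_pi_eq_smul_volume_pi (M := M) (by simp [hM])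
    rw [hM] at this
    simpa [← Matrix.toLin'_apply] using this
  rw [hY]
  refine HasLaw.fun_comp ⟨hM2.aemeasurable, ?_⟩ h
  ext s hs
  rw [Measure.map_apply hM2 hs, withDensity_apply _ (hM2 hs), withDensity_apply _ hs,
    ← lintegral_indicator (hM2 hs), ← lintegral_indicator hs]
  conv_lhs => rw [← hvol]
  rw [lintegral_map (hg.indicator (hM2 hs)) hM1]
  congr 1 with x
  have hx : M *ᵥ x ∈ (fun x => M⁻¹ *ᵥ x) ⁻¹' s ↔ x ∈ s := by rw [Set.mem_preimage, hl]
  by_cases hxs : x ∈ s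
  · rw [Set.indicator_of_mem hxs, Set.indicator_of_mem (hx.2 hxs)]
  · rw [Set.indicator_of_notMem hxs, Set.indicator_of_notMem (hxs ∘ hx.1)]

/-- The pair `(Z, Y)` is the image of the independent pair `(Z, E)` under `(z, e) ↦ (z, m z + e)`,
which carries the product law to `P.map Z ⊗ₘ κ`. -/
lemma hasCondDistrib_add_of_indepFun [IsProbabilityMeasure P] {S : Type*} [MeasurableSpace S]
    {Z : Ω → S} {E Y : Ω → ℝ} (hZ : AEMeasurable Z P) {ν : Measure ℝ} [IsProbabilityMeasure ν]
    (hE : HasLaw E ν P) (hZE : IndepFun Z E P) {m : S → ℝ} (hm : Measurable m)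
    (hY : ∀ ω, Y ω = m (Z ω) + E ω) {κ : Kernel S ℝ} [IsMarkovKernel κ]
    (hκ : ∀ z, κ z = ν.map (m z + ·)) :
    HasCondDistrib Y Z κ P := by
  have hpZ := Measure.isProbabilityMeasure_map hZ
  have hlaw := IndepFun.hasLaw_prod (⟨hZ, rfl⟩ : HasLaw Z (P.map Z) P) hE hZE
  have hΦ : Measurable fun p : S × ℝ => (p.1, m p.1 + p.2) := by fun_prop
  have : HasLaw (fun p : S × ℝ => (p.1, m p.1 + p.2)) (P.map Z ⊗ₘ κ) ((P.map Z).prod ν) := by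
    refine ⟨hΦ.aemeasurable, ?_⟩
    ext s hs
    rw [Measure.map_apply hΦ hs, Measure.prod_apply (hΦ hs), Measure.compProd_apply hs]
    congr 1 with z
    rw [hκ, Measure.map_apply (by fun_prop) (measurable_prodMk_left hs)]
    rfl
  have h := this.fun_comp hlaw
  simp only [← hY] at h
  exact h

end ProbabilityTheory

namespace IntegratedBrownian

/-! ### The normal densities -/

lemma normalDensity_sub_eq {v : ℝ} (hv : 0 ≤ v) (m y : ℝ) :
    normalDensity v (y - m) = gaussianPDFReal m v.toNNReal y := by
  rw [normalDensity, gaussianPDFReal, Real.coe_toNNReal _ hv, one_div]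
  congr 2
  ring

lemma normalDensity_nonneg (v u : ℝ) : 0 ≤ normalDensity v u := by
  unfold normalDensity
  positivity

lemma measurable_normalDensity (v : ℝ) : Measurable (normalDensity v) := by
  unfold normalDensity
  fun_prop

lemma gaussianReal_eq_withDensity_normalDensity {v : ℝ} (hv : 0 < v) (m : ℝ) :
    gaussianReal m v.toNNReal =
      volume.withDensity fun y => ENNReal.ofReal (normalDensity v (y - m)) := by
  rw [gaussianReal_of_var_ne_zero _ (by simpa using hv)]
  congr 1 with y
  rw [gaussianPDF, normalDensity_sub_eq hv.le]

lemma gaussianReal_zero_eq_withDensity_normalDensity {v : ℝ} (hv : 0 < v) :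
    gaussianReal 0 v.toNNReal =
      volume.withDensity fun y => ENNReal.ofReal (normalDensity v y) := by
  simpa using gaussianReal_eq_withDensity_normalDensity hv 0

lemma isDensity_of_hasLaw_gaussianReal {Ω : Type*} [MeasurableSpace Ω] {P : Measure Ω}
    {Y : Ω → ℝ} {v : ℝ} (hv : 0 < v)
    (h : HasLaw Y (gaussianReal 0 v.toNNReal) P) : IsDensity Y (normalDensity v) P :=
  ⟨measurable_normalDensity v, normalDensity_nonneg v,
    gaussianReal_zero_eq_withDensity_normalDensity hv ▸ h⟩

/-- The variance is chosen so that `c_k² / σ_k² = 2k + 1`; this is where the diagonal of `Λ` comes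
from. -/
lemma normalDensity_sigmaSq (k : ℕ) (u : ℝ) :
    normalDensity (sigmaSq k) (coeffC k * u) =
      1 / √(2 * Real.pi * sigmaSq k) * Real.exp (-(1 / 2) * ((2 * (k : ℝ) + 1) * u ^ 2)) := by
  have hc := (coeffC_pos k).ne'
  have hk : (2 * (k : ℝ) + 1) ≠ 0 := by positivity
  rw [normalDensity]
  congr 2
  rw [sigmaSq]
  field_simp

/-! ### The innovation matrix -/

lemma sum_range_coeffA {n k : ℕ} (hk : k < n) (x : ℕ → ℝ) :
    ∑ j : Fin n, coeffA k j * x j = ∑ j ∈ Finset.range (k + 1), coeffA k j * x j := by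
  rw [Fin.sum_univ_eq_sum_range fun j => coeffA k j * x j]
  symm
  refine Finset.sum_subset (Finset.range_mono hk) fun j _ hj => ?_
  rw [coeffA_eq_zero (by simpa using hj), zero_mul]

lemma sum_coeffA {n k : ℕ} (hk : k < n) (x : Fin n → ℝ) :
    ∑ j : Fin n, coeffA k j * x j =
      ∑ j : Fin k, coeffA k j * x (Fin.castLE hk.le j) + coeffA k k * x ⟨k, hk⟩ := by
  have h := sum_range_coeffA hk fun j => if h : j < n then x ⟨j, h⟩ else 0
  simp only [Fin.is_lt, dite_true, Fin.eta] at h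
  rw [h, Finset.sum_range_succ, dif_pos hk,
    ← Fin.sum_univ_eq_sum_range fun j => coeffA k j * if h : j < n then x ⟨j, h⟩ else 0]
  congr 1
  refine Finset.sum_congr rfl fun j _ => ?_
  rw [dif_pos (j.2.trans hk)]
  rfl

/-- The unitriangular matrix mapping `(X₀, …, X_{n-1})` to the innovations. -/
noncomputable def innovMat (n : ℕ) : Matrix (Fin n) (Fin n) ℝ :=
  Matrix.of fun k j => coeffC k * coeffA k j

lemma det_innovMat (n : ℕ) : (innovMat n).det = 1 := by
  rw [Matrix.det_of_isLowerTriangular]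
  · simp [innovMat, coeffC_mul_coeffA_self]
  · intro i j hij
    have : (i : ℕ) < j := hij
    simp [innovMat, coeffA_eq_zero this]

lemma innovMat_mulVec (n : ℕ) (x : Fin n → ℝ) (k : Fin n) :
    (innovMat n *ᵥ x) k = coeffC k * ∑ j : Fin n, coeffA k j * x j := by
  simp [innovMat, Matrix.mulVec, dotProduct, Finset.mul_sum, mul_assoc]

variable {Ω : Type*} {B : ℝ≥0 → Ω → ℝ}

lemma innovMat_mulVec_firstX (n : ℕ) (t : ℝ) (ω : Ω) (k : Fin n) :
    (innovMat n *ᵥ firstX B n t ω) k = coeffC k * stdInnov B k t ω := by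
  rw [innovMat_mulVec, stdInnov]
  simp only [firstX, sum_range_coeffA k.2 fun j => X B j t ω]

/-- The regression function of `Xₖ(t)` on `X₀(t), …, X_{k-1}(t)`. -/
noncomputable def condMean (k : ℕ) (z : Fin k → ℝ) : ℝ :=
  -(coeffC k * ∑ j : Fin k, coeffA k j * z j)

lemma coeffC_mul_sum_eq_sub_condMean (k : ℕ) (z : Fin k → ℝ) (y : ℝ) :
    coeffC k * (∑ j : Fin k, coeffA k j * z j + coeffA k k * y) = y - condMean k z := by
  rw [mul_add, ← mul_assoc, coeffC_mul_coeffA_self, condMean]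
  ring

lemma coeffC_mul_stdInnov_eq (k : ℕ) (t : ℝ) (ω : Ω) :
    coeffC k * stdInnov B k t ω = X B k t ω - condMean k (firstX B k t ω) := by
  rw [← coeffC_mul_sum_eq_sub_condMean, stdInnov, Finset.sum_range_succ,
    ← Fin.sum_univ_eq_sum_range fun j => coeffA k j * X B j t ω]
  rfl

variable [MeasurableSpace Ω] {P : Measure Ω} [IsProbabilityMeasure P]

lemma hasLaw_coeffC_mul_stdInnov (hB : IsBrownianReal B P) (k : ℕ) (t : ℝ) :
    HasLaw (fun ω => coeffC k * stdInnov B k t ω) (gaussianReal 0 (sigmaSq k).toNNReal) P := by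
  have h := gaussianReal_const_mul (hasLaw_stdInnov hB k t) (coeffC k)
  have hv : NNReal.mk (coeffC k ^ 2) (sq_nonneg _) * (1 / (2 * (k : ℝ) + 1)).toNNReal =
      (sigmaSq k).toNNReal := by
    rw [← NNReal.coe_inj, NNReal.coe_mul, Real.coe_toNNReal _ (by positivity),
      Real.coe_toNNReal _ (sigmaSq_pos k).le, NNReal.coe_mk, sigmaSq]
    ring
  rwa [hv, mul_zero] at h

lemma iIndepFun_coeffC_mul_stdInnov (hB : IsBrownianReal B P) (n : ℕ) (t : ℝ) :
    iIndepFun (fun (k : Fin n) ω => coeffC k * stdInnov B k t ω) P :=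
  (iIndepFun_stdInnov hB n t).comp (fun k x => coeffC k * x) fun k => by fun_prop

/-- The joint density of `(X₀(t), …, X_{n-1}(t))`. -/
noncomputable def jointDensity (n : ℕ) (x : Fin n → ℝ) : ℝ :=
  ∏ k : Fin n, normalDensity (sigmaSq k) (coeffC k * ∑ j : Fin n, coeffA k j * x j)

lemma isDensity_firstX (hB : IsBrownianReal B P) (n : ℕ) (t : ℝ) :
    IsDensity (firstX B n t) (jointDensity n) P := by
  have hmn := measurable_normalDensity
  refine ⟨?_, fun x => Finset.prod_nonneg fun k _ => normalDensity_nonneg _ _, ?_⟩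
  · unfold jointDensity
    fun_prop
  have hd := fun k : Fin n => gaussianReal_zero_eq_withDensity_normalDensity (sigmaSq_pos k)
  have hinst : ∀ k : Fin n, SigmaFinite ((volume : Measure ℝ).withDensity
      fun y => ENNReal.ofReal (normalDensity (sigmaSq k) y)) := fun k => by
    rw [← hd k]
    infer_instance
  have h := (iIndepFun_coeffC_mul_stdInnov hB n t).hasLaw_pi
    fun k : Fin n => hasLaw_coeffC_mul_stdInnov hB k t
  simp_rw [hd] at h
  rw [pi_withDensity_eq _ fun k => by fun_prop] at h
  simp_rw [← innovMat_mulVec_firstX] at h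
  have h' := HasLaw.withDensity_of_mulVec (det_innovMat n) (by fun_prop) h
  convert h' using 3 with x
  rw [jointDensity, ENNReal.ofReal_prod_of_nonneg fun k _ => normalDensity_nonneg _ _]
  simp_rw [innovMat_mulVec]

/-! ### Conditional distributions and innovations -/

lemma aemeasurable_firstX (hB : IsBrownianReal B P) (n : ℕ) (t : ℝ) :
    AEMeasurable (firstX B n t) P :=
  (isDensity_firstX hB n t).2.2.aemeasurable

/-- Inverting the unitriangular matrix makes `(X_0, ..., X_{k-1})` a function of the innovations of
index below `k`, which are independent of the `k`-th. -/
lemma indepFun_firstX_stdInnov (hB : IsBrownianReal B P) (k : ℕ) (t : ℝ) :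
    IndepFun (firstX B k t) (fun ω => coeffC k * stdInnov B k t ω) P := by
  have hm := fun j => (hasLaw_coeffC_mul_stdInnov hB j t).aemeasurable
  have h := (iIndepFun_coeffC_mul_stdInnov hB (k + 1) t).indepFun_finset₀
    (Finset.univ.erase (Fin.last k)) {Fin.last k} (by simp) fun j : Fin (k + 1) => hm j
  have hφ : Measurable fun y : (Finset.univ.erase (Fin.last k) : Finset (Fin (k + 1))) → ℝ =>
      (innovMat k)⁻¹ *ᵥ fun j : Fin k => y ⟨j.castSucc, by simp [Fin.castSucc_ne_last]⟩ := by
    have : Measurable fun x : Fin k → ℝ => (innovMat k)⁻¹ *ᵥ x :=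
      (Continuous.matrix_mulVec continuous_const continuous_id).measurable
    exact this.comp (by fun_prop)
  have hψ : Measurable fun y : ({Fin.last k} : Finset (Fin (k + 1))) → ℝ =>
      y ⟨Fin.last k, by simp⟩ := measurable_pi_apply _
  have h' := h.comp hφ hψ
  refine IndepFun.congr h' (.of_forall fun ω => Eq.symm ?_) (.of_forall fun _ => rfl)
  have h1 : (fun j : Fin k => coeffC j * stdInnov B j t ω) = innovMat k *ᵥ firstX B k t ω :=
    funext fun j => (innovMat_mulVec_firstX k t ω j).symm
  have hu : IsUnit (innovMat k).det := by simp [det_innovMat]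
  change _ = (innovMat k)⁻¹ *ᵥ fun j : Fin k => coeffC j * stdInnov B j t ω
  rw [h1, Matrix.mulVec_mulVec, Matrix.nonsing_inv_mul _ hu, Matrix.one_mulVec]

lemma measurable_condMean (k : ℕ) : Measurable (condMean k) := by
  unfold condMean
  fun_prop

/-- The conditional law of `Xₖ(t)` given `X₀(t), …, X_{k-1}(t)`. -/
noncomputable def condKernelX (k : ℕ) : Kernel (Fin k → ℝ) ℝ where
  toFun z := gaussianReal (condMean k z) (sigmaSq k).toNNReal
  measurable' := measurable_gaussianReal.comp ((measurable_condMean k).prodMk measurable_const)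

lemma condKernelX_apply (k : ℕ) (z : Fin k → ℝ) :
    condKernelX k z = gaussianReal (condMean k z) (sigmaSq k).toNNReal := rfl

instance (k : ℕ) : IsMarkovKernel (condKernelX k) :=
  ⟨fun z => by rw [condKernelX_apply]; infer_instance⟩

lemma hasCondDistrib_X (hB : IsBrownianReal B P) (k : ℕ) (t : ℝ) :
    HasCondDistrib (X B k t) (firstX B k t) (condKernelX k) P :=
  hasCondDistrib_add_of_indepFun (aemeasurable_firstX hB k t) (hasLaw_coeffC_mul_stdInnov hB k t)
    (indepFun_firstX_stdInnov hB k t) (measurable_condMean k)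
    (fun ω => by rw [coeffC_mul_stdInnov_eq]; ring)
    (fun z => by rw [condKernelX_apply, gaussianReal_map_const_add, zero_add])

/-- The conditional density of `Xₖ(t)` given `X₀(t), …, X_{k-1}(t)`. -/
noncomputable def condDensityX (k : ℕ) (z : Fin k → ℝ) (y : ℝ) : ℝ :=
  normalDensity (sigmaSq k) (coeffC k * (∑ j : Fin k, coeffA k j * z j + coeffA k k * y))

lemma isCondDensity_X (hB : IsBrownianReal B P) (k : ℕ) (t : ℝ) :
    IsCondDensity (X B k t) (firstX B k t) (condDensityX k) P := by
  refine ⟨?_, fun z y => normalDensity_nonneg _ _, condKernelX k, inferInstance, fun z => ?_,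
    hasCondDistrib_X hB k t⟩
  · have hmn := measurable_normalDensity
    unfold Function.uncurry condDensityX
    fun_prop
  · rw [condKernelX_apply, gaussianReal_eq_withDensity_normalDensity (sigmaSq_pos k)]
    simp_rw [condDensityX, coeffC_mul_sum_eq_sub_condMean]

/-- Regular conditional distributions are unique almost everywhere, so the mean in `innovation` is
that of the explicit Gaussian kernel, namely `condMean`. -/
lemma innovation_ae_eq (hB : IsBrownianReal B P) (k : ℕ) (t : ℝ) :
    innovation B P k t =ᵐ[P] fun ω => coeffC k * stdInnov B k t ω := by
  have hc := hasCondDistrib_X hB k t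
  have h := condDistrib_ae_eq_of_measure_eq_compProd (firstX B k t)
    hc.aemeasurable_snd hc.map_eq
  filter_upwards [ae_of_ae_map (aemeasurable_firstX hB k t) h] with ω hω
  rw [innovation, hω, condKernelX_apply, integral_id_gaussianReal, coeffC_mul_stdInnov_eq]

lemma isDensity_innovation (hB : IsBrownianReal B P) (k : ℕ) (t : ℝ) :
    IsDensity (innovation B P k t) (normalDensity (sigmaSq k)) P :=
  isDensity_of_hasLaw_gaussianReal (sigmaSq_pos k)
    ((hasLaw_coeffC_mul_stdInnov hB k t).congr (innovation_ae_eq hB k t))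

lemma isDensity_X_zero (hB : IsBrownianReal B P) (t : ℝ) :
    IsDensity (X B 0 t) (normalDensity (sigmaSq 0)) P := by
  refine isDensity_of_hasLaw_gaussianReal (sigmaSq_pos 0)
    ((hasLaw_coeffC_mul_stdInnov hB 0 t).congr (.of_forall fun ω => ?_))
  simp [coeffC_mul_stdInnov_eq, condMean]

/-! ### Explicit forms of the joint density -/

/-- By triangularity the `k`-th factor involves only `x_0, ..., x_k`, and so is already the `k`-th
conditional density. -/
lemma jointDensity_eq_prod_condDensityX (n : ℕ) (x : Fin (n + 1) → ℝ) :
    jointDensity (n + 1) x = normalDensity (sigmaSq 0) (x 0) * ∏ k : Fin n,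
      condDensityX (k + 1) (fun j : Fin (k + 1) => x (Fin.castLE k.succ.2.le j)) (x k.succ) := by
  rw [jointDensity, Fin.prod_univ_succ]
  congr 1
  · have := sum_coeffA (Nat.succ_pos n) x
    have h0 := coeffC_mul_coeffA_self 0
    simp only [Fin.val_zero, this, mul_add, ← mul_assoc, h0]
    simp
  · refine Finset.prod_congr rfl fun k _ => ?_
    rw [condDensityX]
    have := sum_coeffA k.succ.2 x
    rw [this]
    rfl

lemma jointDensity_eq_exp (n : ℕ) (x : Fin n → ℝ) :
    jointDensity n x = (∏ k ∈ Finset.range n, 1 / √(2 * Real.pi * sigmaSq k)) *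
      Real.exp (-(1 / 2) * ∑ k : Fin n, (2 * ((k : ℕ) : ℝ) + 1) *
        (∑ j : Fin n, coeffA k j * x j) ^ 2) := by
  simp_rw [jointDensity, normalDensity_sigmaSq]
  rw [Finset.prod_mul_distrib, ← Real.exp_sum, Finset.mul_sum,
    Fin.prod_univ_eq_prod_range fun k => 1 / √(2 * Real.pi * sigmaSq k)]

lemma sum_filter_coeffA {n : ℕ} (x : Fin n → ℝ) (k : Fin n) :
    ∑ j ∈ Finset.univ.filter (fun j : Fin n => j ≤ k), coeffA k j * x j =
      ∑ j : Fin n, coeffA k j * x j := by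
  refine Finset.sum_subset (Finset.filter_subset _ _) fun j _ hj => ?_
  have hj' : (k : ℕ) < j := by simpa using hj
  rw [coeffA_eq_zero hj', zero_mul]

lemma dotProduct_matLambda (n : ℕ) (x : Fin (n + 1) → ℝ) :
    (matA n *ᵥ x) ⬝ᵥ (matLambda n *ᵥ (matA n *ᵥ x)) =
      ∑ k : Fin (n + 1), (2 * ((k : ℕ) : ℝ) + 1) *
        (∑ j : Fin (n + 1), coeffA k j * x j) ^ 2 := by
  rw [dotProduct]
  refine Finset.sum_congr rfl fun k _ => ?_
  rw [matLambda, Matrix.mulVec_diagonal]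
  simp only [matA, Matrix.mulVec, dotProduct, Matrix.of_apply]
  ring

end IntegratedBrownian

open IntegratedBrownian in
theorem proposition5p1 {Ω : Type*} [MeasurableSpace Ω] (P : Measure Ω) [IsProbabilityMeasure P]
    (B : ℝ≥0 → Ω → ℝ) (hB : IsBrownianReal B P) (n : ℕ) (t : ℝ) :
    ∃ (p₀ : ℝ → ℝ) (q : (k : ℕ) → (Fin k → ℝ) → ℝ → ℝ) (p : (Fin (n + 1) → ℝ) → ℝ),
      -- `p` is the joint density, `p₀` the density of `X₀(t)`, and `q k` the conditional density
      -- of `Xₖ(t)` given `X₀(t), …, X_{k-1}(t)`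
      IsDensity (firstX B (n + 1) t) p P ∧
      IsDensity (X B 0 t) p₀ P ∧
      (∀ k, 1 ≤ k → k ≤ n → IsCondDensity (X B k t) (firstX B k t) (q k) P) ∧
      -- the innovations and their densities
      (∀ k ≤ n,
        (innovation B P k t =ᵐ[P] fun ω =>
          coeffC k * ∑ j ∈ Finset.range (k + 1), coeffA k j * X B j t ω) ∧
        IsDensity (innovation B P k t) (normalDensity (sigmaSq k)) P) ∧
      -- `p₀` and the conditional densities through the innovation densities
      (∀ y, p₀ y = normalDensity (sigmaSq 0) y) ∧
      (∀ k, 1 ≤ k → k ≤ n → ∀ (z : Fin k → ℝ) (y : ℝ),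
        q k z y = normalDensity (sigmaSq k)
          (coeffC k * (∑ j : Fin k, coeffA k j * z j + coeffA k k * y))) ∧
      -- the factorization and the two explicit forms of the joint density
      (∀ x : Fin (n + 1) → ℝ,
        p x = p₀ (x 0) * ∏ k : Fin n,
          q (k + 1) (fun j : Fin (k + 1) => x (Fin.castLE (by omega) j)) (x k.succ)) ∧
      (∀ x : Fin (n + 1) → ℝ,
        p x = (∏ k ∈ Finset.range (n + 1), 1 / √(2 * Real.pi * sigmaSq k)) *
          Real.exp (-(1 / 2) * ∑ k : Fin (n + 1), (2 * ((k : ℕ) : ℝ) + 1) *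
            (∑ j ∈ Finset.univ.filter (fun j : Fin (n + 1) => j ≤ k), coeffA k j * x j) ^ 2)) ∧
      (∀ x : Fin (n + 1) → ℝ,
        p x = (∏ k ∈ Finset.range (n + 1), 1 / √(2 * Real.pi * sigmaSq k)) *
          Real.exp (-(1 / 2) * ((matA n *ᵥ x) ⬝ᵥ (matLambda n *ᵥ (matA n *ᵥ x))))) := by
  refine ⟨normalDensity (sigmaSq 0), condDensityX, jointDensity (n + 1),
    isDensity_firstX hB (n + 1) t, isDensity_X_zero hB t,
    fun k _ _ => isCondDensity_X hB k t,
    fun k _ => ⟨innovation_ae_eq hB k t, isDensity_innovation hB k t⟩,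
    fun _ => rfl, fun _ _ _ _ _ => rfl, jointDensity_eq_prod_condDensityX n, fun x => ?_,
    fun x => ?_⟩
  · simp_rw [sum_filter_coeffA]
    exact jointDensity_eq_exp (n + 1) x
  · rw [dotProduct_matLambda]
    exact jointDensity_eq_exp (n + 1) x
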